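/- Let $(a,b,c,d)\in(-2,2)^4$, and let $S$ be the set of rational numbers that are not integers $i$ with $-8\le i\le 8$. Put $$w_0=ab+cd,\qquad w_1=ad+bc,\qquad w_2=ac+bd .$$ Let $V\subset\mathbb R^3$ be the cubic surface of all $p=(p_0,p_1,p_2)=(x,y,z)$ with $$x^2+y^2+z^2+xyz=w_0x+w_1y+w_2z-(a^2+b^2+c^2+d^2+abcd-4),$$ which contains the compact component of the relative character variety of the four-holed sphere with boundary traces $(a,b,c,d)$. The Dehn twists $\tau_0=\tau_X$, $\tau_1=\tau_Y$, $\tau_2=\tau_Z$ are given as follows (indices mod $3$): $\tau_k$ fixes $p_k$, and replaces $p_{k-1}$ by $p_{k-1}'=w_{k-1}-p_kp_{k+1}-p_{k-1}$ and $p_{k+1}$ by $w_{k+1}-p_kp_{k-1}'-p_{k+1}$. For $|t|<2$ the level set $\{p\in V: p_k=t\}$ is empty, a point, or an ellipse; call it a circle if it has more than one point. Suppose that $w_i,w_j\in S$ for two distinct indices $i,j$. Then for each $k\in\{i,j\}$: 1. The equation $$\cos\theta'+\cos(\theta_{3}+\theta_{2})+\cos(\theta_{3}-\theta_{2})+\cos\theta_{1}=\frac{w_k}{2}$$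 has no solution in which all the angles $\theta',\theta_1,\theta_2,\theta_3$ are rational multiples of $\pi$. 2. Consequently, let $p\in V$ and $q=\tau_{k+1}(p)$. Suppose that $|p_0|,|p_1|,|p_2|,|q_k|<2$ and that the level sets of the three coordinates through $p$ and the level set of the $k$-th coordinate through $q$ are circles. Then the orbits of $p$ under $\langle\tau_0\rangle$, $\langle\tau_1\rangle$, $\langle\tau_2\rangle$ and the orbit of $q$ under $\langle\tau_k\rangle$ are not all finite. -/

import Mathlib

namespace FourHoledSphere

/-- The rational numbers other than the integers from `-8` to `8`, as a set of reals. -/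
def admissible : Set ℝ :=
  {t | (∃ q : ℚ, (q : ℝ) = t) ∧ ¬ ∃ i : ℤ, -8 ≤ i ∧ i ≤ 8 ∧ (i : ℝ) = t}

/-- `θ` is a rational multiple of `π`. -/
def IsRationalAngle (θ : ℝ) : Prop := ∃ q : ℚ, θ = q * Real.pi

/-- The cosine equation
`cos θx' + cos (θz + θy) + cos (θz - θy) + cos θx = w / 2`
has a solution in rational multiples of `π`.  No range is imposed on the angles. -/
def HasRationalSolution (w : ℝ) : Prop :=
  ∃ θx' θx θy θz : ℝ,
    IsRationalAngle θx' ∧ IsRationalAngle θx ∧ IsRationalAngle θy ∧ IsRationalAngle θz ∧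
    Real.cos θx' + Real.cos (θz + θy) + Real.cos (θz - θy) + Real.cos θx = w / 2

/-- The coefficients of `x`, `y`, `z` (indices `0`, `1`, `2`) in the cubic equation
of the moduli space with boundary traces `(a, b, c, d)`. -/
def coeff (a b c d : ℝ) : Fin 3 → ℝ := ![a * b + c * d, a * d + b * c, a * c + b * d]

/-- The real points `p = (x, y, z) = (p 0, p 1, p 2)` of the cubic surface
`x² + y² + z² + xyz = (ab+cd) x + (ad+bc) y + (ac+bd) z - (a² + b² + c² + d² + abcd - 4)`. -/
def surface (a b c d : ℝ) : Set (Fin 3 → ℝ) :=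
  {p | p 0 ^ 2 + p 1 ^ 2 + p 2 ^ 2 + p 0 * p 1 * p 2 =
    (a * b + c * d) * p 0 + (a * d + b * c) * p 1 + (a * c + b * d) * p 2
      - (a ^ 2 + b ^ 2 + c ^ 2 + d ^ 2 + a * b * c * d - 4)}

/-- The level set of the `k`-th coordinate at height `t`: `X(t)`, `Y(t)`, `Z(t)` for
`k = 0, 1, 2`. -/
def levelSet (a b c d : ℝ) (k : Fin 3) (t : ℝ) : Set (Fin 3 → ℝ) :=
  {p | p ∈ surface a b c d ∧ p k = t}

/-- The level set is a circle.  For `|t| < 2` it is cut out of the plane `p k = t` by a quadratic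
equation in the two other coordinates `u, v` with positive definite leading part
`u² + v² + t u v`, so it is empty, a single point, or an ellipse; it is an ellipse exactly when it
has at least two points. -/
def IsCircleLevel (a b c d : ℝ) (k : Fin 3) (t : ℝ) : Prop :=
  -2 < t ∧ t < 2 ∧ (levelSet a b c d k t).Nontrivial

/-- Replace the `k`-th coordinate by `w k` minus the product of the two other coordinates minus
itself (`w` is the vector of coefficients; indices are taken modulo 3). -/
def flipCoord (w : Fin 3 → ℝ) (k : Fin 3) (p : Fin 3 → ℝ) : Fin 3 → ℝ :=
  Function.update p k (w k - p (k + 1) * p (k + 2) - p k)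

theorem flipCoord_involutive (w : Fin 3 → ℝ) (k : Fin 3) :
    Function.Involutive (flipCoord w k) := by
  intro p
  funext j
  fin_cases k <;> fin_cases j <;> simp [flipCoord, Function.update]

/-- The Dehn twists `τ_X`, `τ_Y`, `τ_Z` (for `k = 0, 1, 2`) in coordinates: the coordinate before
the `k`-th one (cyclically) is flipped first, then the coordinate after it.  For example, `τ_Y`
fixes `y` and sends `x` to `x' = ab+cd-yz-x` and `z` to `ac+bd-yx'-z`. -/
def dehnTwist (a b c d : ℝ) (k : Fin 3) : Equiv.Perm (Fin 3 → ℝ) :=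
  (flipCoord_involutive (coeff a b c d) (k + 2)).toPerm.trans
    (flipCoord_involutive (coeff a b c d) (k + 1)).toPerm

/-- The orbit of `p` under the cyclic group generated by a Dehn twist. -/
def twistOrbit (a b c d : ℝ) (k : Fin 3) (p : Fin 3 → ℝ) : Set (Fin 3 → ℝ) :=
  Set.range fun n : ℤ => (dehnTwist a b c d k ^ n) p

end FourHoledSphere

open ComplexConjugate

namespace FourHoledSphere

/-! Both parts write `w k` as an algebraic integer of absolute value at most 8; a rational algebraic
integer is an integer, which `admissible` excludes. For the cosine equation, `w k` is a sum of four
terms `2 * cos` of rational angles. For the orbits, `w k = q k + p k + p (k + 1) * p (k + 2)`, and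
`isIntegral_of_finite_twistOrbit` makes each height integral: a twist rotates its circle by `e ^ 2`
with `e + conj e = -t`, so a finite orbit forces `e` to be a root of unity. -/

/-- A rational number other than the integers from `-8` to `8` that is bounded by `8` in absolute
value is not an algebraic integer. -/
theorem not_isIntegral_of_admissible {w : ℝ} (hw : w ∈ admissible) (hle : |w| ≤ 8) :
    ¬ IsIntegral ℤ w := by
  rintro hint
  obtain ⟨⟨q, rfl⟩, hne⟩ := hw
  have hq : IsIntegral ℤ q :=
    (isIntegral_algHom_iff (Algebra.ofId ℚ ℝ |>.restrictScalars ℤ)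
      (algebraMap ℚ ℝ).injective).1 hint
  obtain ⟨n, rfl⟩ := IsIntegrallyClosed.isIntegral_iff.1 hq
  rw [abs_le] at hle
  refine hne ⟨n, ?_, ?_, by simp⟩
  · have := hle.1
    simp only [eq_intCast, Rat.cast_intCast] at this
    exact_mod_cast this
  · have := hle.2
    simp only [eq_intCast, Rat.cast_intCast] at this
    exact_mod_cast this

theorem IsRationalAngle.add {s t : ℝ} (hs : IsRationalAngle s) (ht : IsRationalAngle t) :
    IsRationalAngle (s + t) := by
  obtain ⟨q, rfl⟩ := hs
  obtain ⟨r, rfl⟩ := ht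
  exact ⟨q + r, by push_cast; ring⟩

theorem IsRationalAngle.sub {s t : ℝ} (hs : IsRationalAngle s) (ht : IsRationalAngle t) :
    IsRationalAngle (s - t) := by
  obtain ⟨q, rfl⟩ := hs
  obtain ⟨r, rfl⟩ := ht
  exact ⟨q - r, by push_cast; ring⟩

theorem IsRationalAngle.isIntegral_two_mul_cos {θ : ℝ} (h : IsRationalAngle θ) :
    IsIntegral ℤ (2 * Real.cos θ) := by
  obtain ⟨q, rfl⟩ := h
  exact Real.isIntegral_two_mul_cos_rat_mul_pi q

theorem not_hasRationalSolution {w : ℝ} (hw : w ∈ admissible) : ¬ HasRationalSolution w := by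
  rintro ⟨α, β, γ, δ, hα, hβ, hγ, hδ, h⟩
  have hsum : w = 2 * Real.cos α + 2 * Real.cos (δ + γ) + 2 * Real.cos (δ - γ)
      + 2 * Real.cos β := by linarith
  refine not_isIntegral_of_admissible hw ?_ ?_
  · rw [hsum, abs_le]
    constructor <;>
      linarith [Real.neg_one_le_cos α, Real.neg_one_le_cos (δ + γ), Real.neg_one_le_cos (δ - γ),
        Real.neg_one_le_cos β, Real.cos_le_one α, Real.cos_le_one (δ + γ),
        Real.cos_le_one (δ - γ), Real.cos_le_one β]
  · rw [hsum]
    exact ((hα.isIntegral_two_mul_cos.add (hδ.add hγ).isIntegral_two_mul_cos).add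
      (hδ.sub hγ).isIntegral_two_mul_cos).add hβ.isIntegral_two_mul_cos

section Twist

variable (a b c d : ℝ) (k : Fin 3) (p : Fin 3 → ℝ)

theorem dehnTwist_apply_self : dehnTwist a b c d k p k = p k := by
  fin_cases k <;> simp [dehnTwist, flipCoord, Function.update]

theorem dehnTwist_apply_add_two : dehnTwist a b c d k p (k + 2) =
    coeff a b c d (k + 2) - p k * p (k + 1) - p (k + 2) := by
  fin_cases k <;> simp [dehnTwist, flipCoord, Function.update]

theorem dehnTwist_apply_add_one : dehnTwist a b c d k p (k + 1) =
    coeff a b c d (k + 1) - p k * dehnTwist a b c d k p (k + 2) - p (k + 1) := by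
  fin_cases k <;> simp [dehnTwist, flipCoord, Function.update] <;> ring

/-- Cyclically `k` precedes `k + 1`, so it is flipped first and only old coordinates enter. -/
theorem dehnTwist_add_one_apply : dehnTwist a b c d (k + 1) p k =
    coeff a b c d k - p (k + 1) * p (k + 2) - p k := by
  fin_cases k <;> simp [dehnTwist, flipCoord, Function.update]

theorem mem_surface_iff : p ∈ surface a b c d ↔
    p k ^ 2 + p (k + 1) ^ 2 + p (k + 2) ^ 2 + p k * p (k + 1) * p (k + 2) =
      coeff a b c d k * p k + coeff a b c d (k + 1) * p (k + 1)
        + coeff a b c d (k + 2) * p (k + 2)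
        - (a ^ 2 + b ^ 2 + c ^ 2 + d ^ 2 + a * b * c * d - 4) := by
  fin_cases k <;> simp [surface, coeff] <;> constructor <;> intro h <;> linarith

-- Each flip exchanges the two roots of the surface equation, read as a quadratic in that
-- coordinate.
variable {p} in
theorem dehnTwist_mem_surface (hp : p ∈ surface a b c d) :
    dehnTwist a b c d k p ∈ surface a b c d := by
  rw [mem_surface_iff a b c d k] at hp ⊢
  rw [dehnTwist_apply_add_one, dehnTwist_apply_add_two, dehnTwist_apply_self]
  linear_combination hp

end Twist

theorem funext_cyclic {k : Fin 3} {p r : Fin 3 → ℝ} (h0 : p k = r k) (h1 : p (k + 1) = r (k + 1))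
    (h2 : p (k + 2) = r (k + 2)) : p = r := by
  funext j
  fin_cases k <;> fin_cases j <;> simp_all

/-- A level set that is a circle does not contain its centre. -/
theorem IsCircleLevel.ne_center {a b c d t : ℝ} {k : Fin 3} (h : IsCircleLevel a b c d k t)
    {p : Fin 3 → ℝ} (hp : p ∈ levelSet a b c d k t) :
    ¬ (2 * p (k + 1) + t * p (k + 2) = coeff a b c d (k + 1) ∧
      t * p (k + 1) + 2 * p (k + 2) = coeff a b c d (k + 2)) := by
  rintro ⟨h1, h2⟩
  obtain ⟨hl, hu, hn⟩ := h
  obtain ⟨r, hr, hrp⟩ := hn.exists_ne p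
  obtain ⟨hps, hpk⟩ := hp
  obtain ⟨hrs, hrk⟩ := hr
  rw [mem_surface_iff a b c d k, hpk] at hps
  rw [mem_surface_iff a b c d k, hrk] at hrs
  set x := r (k + 1) - p (k + 1) with hx
  set y := r (k + 2) - p (k + 2) with hy
  -- At the centre the linear terms of the difference cancel, leaving the quadratic form.
  have hQ : x ^ 2 + y ^ 2 + t * x * y = 0 := by
    rw [← h1, ← h2] at hps hrs
    simp only [hx, hy]
    linear_combination hrs - hps
  have hpos : 0 < 4 - t ^ 2 := by nlinarith
  have hy0 : y = 0 := by
    -- Complete the square: `4Q = (2x + ty)² + (4 - t²)y²`.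
    have : (4 - t ^ 2) * y ^ 2 ≤ 0 := by nlinarith [sq_nonneg (2 * x + t * y)]
    by_contra hne
    have := mul_pos hpos (pow_pos (abs_pos.2 hne) 2)
    rw [sq_abs] at this
    linarith
  have hx0 : x = 0 := by
    rw [hy0] at hQ
    exact pow_eq_zero_iff two_ne_zero |>.1 (by linarith)
  exact hrp (funext_cyclic (hrk.trans hpk.symm) (sub_eq_zero.1 hx0) (sub_eq_zero.1 hy0))

/-- If the twist about the `k`-th coordinate has a finite orbit on a circle, then it acts there as
a rotation of finite order, and the height of the circle is an algebraic integer. -/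
theorem isIntegral_of_finite_twistOrbit {a b c d : ℝ} {k : Fin 3} {p : Fin 3 → ℝ}
    (hp : p ∈ surface a b c d) (h : IsCircleLevel a b c d k (p k))
    (hfin : (twistOrbit a b c d k p).Finite) : IsIntegral ℤ (p k) := by
  have hcenter := h.ne_center ⟨hp, rfl⟩
  obtain ⟨hl, hu, -⟩ := h
  set t := p k with ht
  have hpos : 0 < 4 - t ^ 2 := by nlinarith
  -- `(u, v)` is the centre of the ellipse, by Cramer's rule.
  set u : ℝ := (2 * coeff a b c d (k + 1) - t * coeff a b c d (k + 2)) / (4 - t ^ 2) with hu'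
  set v : ℝ := (2 * coeff a b c d (k + 2) - t * coeff a b c d (k + 1)) / (4 - t ^ 2) with hv'
  have huv : 2 * u + t * v = coeff a b c d (k + 1) := by
    rw [hu', hv']; field_simp; ring
  have hvu : t * u + 2 * v = coeff a b c d (k + 2) := by
    rw [hu', hv']; field_simp; ring
  have hs : 0 < Real.sqrt (4 - t ^ 2) := Real.sqrt_pos.2 hpos
  obtain ⟨e, hre, him⟩ : ∃ e : ℂ, e.re = -t / 2 ∧ e.im = Real.sqrt (4 - t ^ 2) / 2 :=
    ⟨⟨_, _⟩, rfl, rfl⟩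
  have hadd : e + conj e = -t := by
    rw [Complex.add_conj, hre]; push_cast; ring
  have hmul : e * conj e = 1 := by
    rw [Complex.mul_conj, Complex.normSq_apply, hre, him]
    norm_cast
    linarith [Real.mul_self_sqrt hpos.le]
  have he0 : e ≠ 0 := left_ne_zero_of_mul_eq_one hmul
  -- A linear factor of the quadratic form about the centre: `|s|² = x² + y² + txy`. It diagonalises
  -- the twist.
  let s : (Fin 3 → ℝ) → ℂ := fun r => ((r (k + 1) - u : ℝ) : ℂ) - conj e * ((r (k + 2) - v : ℝ) : ℂ)
  have hstep : ∀ r : Fin 3 → ℝ, r k = t →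
      s (dehnTwist a b c d k r) = e ^ 2 * s r := by
    intro r hr
    have h2 : dehnTwist a b c d k r (k + 2) - v = -t * (r (k + 1) - u) - (r (k + 2) - v) := by
      rw [dehnTwist_apply_add_two, hr]; linear_combination -hvu
    have h1 : dehnTwist a b c d k r (k + 1) - u
        = -t * (dehnTwist a b c d k r (k + 2) - v) - (r (k + 1) - u) := by
      rw [dehnTwist_apply_add_one, hr]; linear_combination -huv
    simp only [s]
    rw [h1, h2]
    push_cast
    rw [← hadd]
    generalize ((r (k + 1) : ℝ) : ℂ) - u = x
    generalize ((r (k + 2) : ℝ) : ℂ) - v = y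
    linear_combination (x + e * y) * hmul
  have hiter : ∀ n : ℕ, ∀ r : Fin 3 → ℝ, r k = t →
      ((dehnTwist a b c d k ^ n) r) k = t ∧
        s ((dehnTwist a b c d k ^ n) r) = (e ^ 2) ^ n * s r := by
    intro n
    induction n with
    | zero => intro r hr; simp [hr]
    | succ n ih =>
      intro r hr
      obtain ⟨h1, h2⟩ := ih r hr
      rw [pow_succ' (dehnTwist a b c d k), Equiv.Perm.mul_apply, dehnTwist_apply_self, hstep _ h1,
        h2]
      exact ⟨h1, by ring⟩
  -- Since `e` is not real, `s` vanishes only at the centre, which is not on the circle.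
  have hsp : s p ≠ 0 := by
    intro h0
    have hi := congrArg Complex.im h0
    have hr := congrArg Complex.re h0
    simp only [s, Complex.sub_im, Complex.sub_re, Complex.mul_re, Complex.mul_im, Complex.ofReal_re,
      Complex.ofReal_im, Complex.conj_re, Complex.conj_im, Complex.zero_re, Complex.zero_im] at hi hr
    have hv0 : p (k + 2) - v = 0 := by
      have : e.im * (p (k + 2) - v) = 0 := by linarith
      refine (mul_eq_zero.1 this).resolve_left ?_
      rw [him]; positivity
    rw [hv0] at hr
    have hu0 : p (k + 1) - u = 0 := by linarith
    rw [sub_eq_zero] at hu0 hv0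
    exact hcenter ⟨by rw [hu0, hv0, huv], by rw [hu0, hv0, hvu]⟩
  obtain ⟨m, n, hmn, heq⟩ : ∃ m n : ℕ, m < n ∧
      (dehnTwist a b c d k ^ m) p = (dehnTwist a b c d k ^ n) p := by
    obtain ⟨m, -, n, -, hmn, heq⟩ := Set.infinite_univ.exists_lt_map_eq_of_mapsTo
      (f := fun n : ℕ => (dehnTwist a b c d k ^ n) p)
      (t := twistOrbit a b c d k p) (fun n _ => ⟨n, by simp⟩) hfin
    exact ⟨m, n, hmn, heq⟩
  have hpow : e ^ (2 * (n - m)) = 1 := by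
    have h1 := (hiter m p rfl).2
    rw [heq, (hiter n p rfl).2] at h1
    have h2 : (e ^ 2) ^ n = (e ^ 2) ^ m := mul_right_cancel₀ hsp h1
    rw [← Nat.sub_add_cancel hmn.le, pow_add] at h2
    rw [pow_mul]
    exact mul_right_cancel₀ (pow_ne_zero _ (pow_ne_zero _ he0)) (by rw [h2, one_mul])
  have hN : 0 < 2 * (n - m) := by omega
  have hinte : IsIntegral ℤ e := IsIntegral.of_pow hN (hpow ▸ isIntegral_one)
  have hintc : IsIntegral ℤ (conj e) :=
    IsIntegral.of_pow hN (by rw [← map_pow, hpow, map_one]; exact isIntegral_one)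
  have hint : IsIntegral ℤ ((t : ℝ) : ℂ) := by
    have := (hinte.add hintc).neg
    rwa [hadd, neg_neg] at this
  exact (isIntegral_algHom_iff (Complex.ofRealAm.restrictScalars ℤ) Complex.ofReal_injective).1 hint

end FourHoledSphere

theorem proposition4p2 (a b c d : ℝ)
    (ha : a ∈ Set.Ioo (-2 : ℝ) 2) (hb : b ∈ Set.Ioo (-2 : ℝ) 2)
    (hc : c ∈ Set.Ioo (-2 : ℝ) 2) (hd : d ∈ Set.Ioo (-2 : ℝ) 2)
    (i j : Fin 3) (hij : i ≠ j)
    (hi : FourHoledSphere.coeff a b c d i ∈ FourHoledSphere.admissible)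
    (hj : FourHoledSphere.coeff a b c d j ∈ FourHoledSphere.admissible) :
    ∀ k : Fin 3, k = i ∨ k = j →
      ¬ FourHoledSphere.HasRationalSolution (FourHoledSphere.coeff a b c d k) ∧
      ∀ p ∈ FourHoledSphere.surface a b c d,
        ∀ q : Fin 3 → ℝ, q = FourHoledSphere.dehnTwist a b c d (k + 1) p →
        FourHoledSphere.IsCircleLevel a b c d k (p k) →
        FourHoledSphere.IsCircleLevel a b c d (k + 1) (p (k + 1)) →
        FourHoledSphere.IsCircleLevel a b c d (k + 2) (p (k + 2)) →
        FourHoledSphere.IsCircleLevel a b c d k (q k) →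
        ¬ ((FourHoledSphere.twistOrbit a b c d k p).Finite ∧
            (FourHoledSphere.twistOrbit a b c d (k + 1) p).Finite ∧
            (FourHoledSphere.twistOrbit a b c d (k + 2) p).Finite ∧
            (FourHoledSphere.twistOrbit a b c d k q).Finite) := by
  rintro k hk
  have hwk : FourHoledSphere.coeff a b c d k ∈ FourHoledSphere.admissible := by
    rcases hk with rfl | rfl <;> assumption
  refine ⟨FourHoledSphere.not_hasRationalSolution hwk, ?_⟩
  rintro p hp q rfl h0 h1 h2 h3 ⟨f0, f1, f2, f3⟩
  have i0 := FourHoledSphere.isIntegral_of_finite_twistOrbit hp h0 f0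
  have i1 := FourHoledSphere.isIntegral_of_finite_twistOrbit hp h1 f1
  have i2 := FourHoledSphere.isIntegral_of_finite_twistOrbit hp h2 f2
  have i3 := FourHoledSphere.isIntegral_of_finite_twistOrbit
    (FourHoledSphere.dehnTwist_mem_surface a b c d (k + 1) hp) h3 f3
  -- The flip formula solved for `w k`; the heights then give the bound `2 + 2 + 2 * 2 = 8`.
  have hsum : FourHoledSphere.coeff a b c d k =
      FourHoledSphere.dehnTwist a b c d (k + 1) p k + p k + p (k + 1) * p (k + 2) := by
    rw [FourHoledSphere.dehnTwist_add_one_apply]; ring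
  have abs_le_two : ∀ {l : Fin 3} {t : ℝ}, FourHoledSphere.IsCircleLevel a b c d l t → |t| ≤ 2 :=
    fun h => abs_le.2 ⟨h.1.le, h.2.1.le⟩
  refine FourHoledSphere.not_isIntegral_of_admissible hwk ?_ ?_
  · rw [hsum]
    refine (abs_add_three _ _ _).trans ?_
    rw [abs_mul]
    have := mul_le_mul (abs_le_two h1) (abs_le_two h2) (abs_nonneg _) zero_le_two
    linarith [abs_le_two h0, abs_le_two h3]
  · rw [hsum]
    exact (i3.add i0).add (i1.mul i2)
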